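/- Let $n\ge 2$, let $u$ be a nonzero real polynomial on $\mathbb R^n$ which is harmonic ($\Delta u=0$), and let $v:\mathbb R^n\to\mathbb R$ be an entire harmonic function, i.e. $v$ is harmonic on all of $\mathbb R^n$. Write $Z(f)=\{x\in\mathbb R^n : f(x)=0\}$ and suppose that $Z(u)\subseteq Z(v)$. Suppose that there exist $\gamma\ge 0$ and $C>0$ such that $$\left|\frac{v(x)}{u(x)}\right|\le C(1+|x|)^{\gamma}\qquad\text{for all } x\in\mathbb R^n\setminus Z(u),$$ where $|x|$ is the Euclidean norm. Then the ratio $v/u$ is a polynomial of degree at most $\lfloor\gamma\rfloor$; that is, there is a real polynomial $R$ on $\mathbb R^n$, which is either zero or of total degree at most $\lfloor\gamma\rfloor$, such that $v(x)/u(x)=R(x)$ for all $x\in\mathbb R^n\setminus Z(u)$. -/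

import Mathlib

open InnerProductSpace

/-- The function on Euclidean space `ℝⁿ` given by a real polynomial in `n` variables. -/
noncomputable def polyFun {n : ℕ} (p : MvPolynomial (Fin n) ℝ) :
    EuclideanSpace ℝ (Fin n) → ℝ :=
  fun x => MvPolynomial.eval (fun i => x i) p

/-- `f` is an entire harmonic function: it is `C²` with vanishing Laplacian on all of `ℝⁿ`. -/
def EntireHarmonic {n : ℕ} (f : EuclideanSpace ℝ (Fin n) → ℝ) : Prop :=
  HarmonicOnNhd f Set.univ

/-- The zero (nodal) set `Z(f)` of a function on `ℝⁿ`. -/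
def zeroSet {n : ℕ} (f : EuclideanSpace ℝ (Fin n) → ℝ) : Set (EuclideanSpace ℝ (Fin n)) :=
  {x | f x = 0}

open MvPolynomial MeasureTheory Filter Topology

/-! ### Polynomial functions -/

section PolynomialFunctions

variable {n : ℕ}

/-! Since `Z(u) ⊆ Z(v)`, the growth bound on `v / u` becomes `|v| ≤ C (1 + |x|) ^ γ |u|` everywhere.
Thus `v` has polynomial growth and is itself a polynomial by Liouville
(`exists_polyFun_eq_of_harmonic_of_growth`). It remains to show that `u` divides `v`; a bound along
rays then controls the degree of the quotient (`totalDegree_le_floor_of_abs_le`).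

For divisibility, write `u = g a` and `v = g b` with `a`, `b` coprime. The bound survives
cancellation of `g`, so `b` vanishes wherever `a` does. A sign change of `a` would force too many
common zeros of `a` and `b`: eliminating one variable confines these to the zeros of a nonzero
polynomial independent of that variable, so `a` keeps its sign on almost every line parallel to an
axis, hence everywhere (`nonneg_of_isRelPrime_of_zeroSet_subset`).

A harmonic polynomial has no nonconstant factor of constant sign
(`totalDegree_eq_zero_of_nonneg_of_mul_harmonic`): the leading form `gₖ aₗ` of `g a` is harmonic, so
it is Gaussian-orthogonal to the form `gₖ` of smaller degree, and then `gₖ² aₗ`, of constant sign,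
has mean zero. So `a` is constant and `u` divides `v`. -/

lemma polyFun_add (p q : MvPolynomial (Fin n) ℝ) (x : EuclideanSpace ℝ (Fin n)) :
    polyFun (p + q) x = polyFun p x + polyFun q x := by simp [polyFun]

lemma polyFun_mul (p q : MvPolynomial (Fin n) ℝ) (x : EuclideanSpace ℝ (Fin n)) :
    polyFun (p * q) x = polyFun p x * polyFun q x := by simp [polyFun]

lemma polyFun_neg (p : MvPolynomial (Fin n) ℝ) (x : EuclideanSpace ℝ (Fin n)) :
    polyFun (-p) x = -polyFun p x := by simp [polyFun]

lemma polyFun_C (c : ℝ) (x : EuclideanSpace ℝ (Fin n)) : polyFun (C c) x = c := by simp [polyFun]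

lemma polyFun_X (i : Fin n) (x : EuclideanSpace ℝ (Fin n)) : polyFun (X i) x = x i := by
  simp [polyFun]

lemma hasFDerivAt_polyFun (p : MvPolynomial (Fin n) ℝ) (x : EuclideanSpace ℝ (Fin n)) :
    HasFDerivAt (polyFun p)
      (∑ i, polyFun (pderiv i p) x • (EuclideanSpace.proj i : EuclideanSpace ℝ (Fin n) →L[ℝ] ℝ))
      x := by
  induction p using MvPolynomial.induction_on with
  | C a =>
    have : polyFun (C a : MvPolynomial (Fin n) ℝ) = fun _ => a := funext (polyFun_C a)
    rw [this]
    convert! hasFDerivAt_const a x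
    simp [polyFun]
  | add p q hp hq =>
    have : polyFun (p + q) = fun x => polyFun p x + polyFun q x := funext (polyFun_add p q)
    rw [this]
    convert! hp.add hq
    simp [polyFun_add, add_smul, Finset.sum_add_distrib]
  | mul_X p j hp =>
    have : polyFun (p * X j) = fun x => polyFun p x * x j :=
      funext fun x => by rw [polyFun_mul, polyFun_X]
    rw [this]
    convert! hp.mul (EuclideanSpace.proj j : EuclideanSpace ℝ (Fin n) →L[ℝ] ℝ).hasFDerivAt
    ext y
    simp [polyFun, pderiv_X, Pi.single_apply, add_smul, Finset.sum_add_distrib,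
      Finset.mul_sum, mul_assoc, apply_ite]

lemma fderiv_polyFun_single (p : MvPolynomial (Fin n) ℝ) (x : EuclideanSpace ℝ (Fin n))
    (i : Fin n) :
    fderiv ℝ (polyFun p) x (EuclideanSpace.single i 1) = polyFun (pderiv i p) x := by
  rw [(hasFDerivAt_polyFun p x).fderiv]
  simp

lemma differentiable_polyFun (p : MvPolynomial (Fin n) ℝ) : Differentiable ℝ (polyFun p) :=
  fun x => (hasFDerivAt_polyFun p x).differentiableAt

lemma continuous_polyFun (p : MvPolynomial (Fin n) ℝ) : Continuous (polyFun p) :=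
  (differentiable_polyFun p).continuous

/-- A function of class `C²` has as Laplacian the sum of its second partial derivatives. -/
lemma laplacian_eq_sum_fderiv {f : EuclideanSpace ℝ (Fin n) → ℝ} (hf : ContDiff ℝ 2 f)
    (x : EuclideanSpace ℝ (Fin n)) :
    Laplacian.laplacian f x =
      ∑ i, fderiv ℝ (fun y => fderiv ℝ f y (EuclideanSpace.single i 1)) x
        (EuclideanSpace.single i 1) := by
  rw [laplacian_eq_iteratedFDeriv_orthonormalBasis f (EuclideanSpace.basisFun (Fin n) ℝ)]
  refine Finset.sum_congr rfl fun i _ => ?_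
  have hd : DifferentiableAt ℝ (fderiv ℝ f) x :=
    ((hf.fderiv_right (m := 1) (by norm_num)).differentiable (by norm_num)) x
  rw [iteratedFDeriv_two_apply, fderiv_clm_apply hd (differentiableAt_const _)]
  simp

lemma EntireHarmonic.contDiff {f : EuclideanSpace ℝ (Fin n) → ℝ} (hf : EntireHarmonic f) :
    ContDiff ℝ 2 f :=
  contDiff_iff_contDiffAt.2 fun x => (hf x (Set.mem_univ x)).1

lemma EntireHarmonic.laplacian_eq_zero {f : EuclideanSpace ℝ (Fin n) → ℝ} (hf : EntireHarmonic f)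
    (x : EuclideanSpace ℝ (Fin n)) : Laplacian.laplacian f x = 0 :=
  (hf x (Set.mem_univ x)).2.self_of_nhds

/-- A polynomial vanishing on a nonempty open set is zero. -/
lemma eq_zero_of_polyFun_eq_zero_on_open {p : MvPolynomial (Fin n) ℝ}
    {U : Set (EuclideanSpace ℝ (Fin n))} (hU : IsOpen U) (hne : U.Nonempty)
    (h : ∀ x ∈ U, polyFun p x = 0) : p = 0 := by
  obtain ⟨x₀, hx₀⟩ := hne
  have hc : Continuous (fun y : Fin n → ℝ => (WithLp.toLp 2 y : EuclideanSpace ℝ (Fin n))) :=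
    PiLp.continuous_toLp 2 _
  obtain ⟨r, hr, hball⟩ := Metric.isOpen_iff.1 (hU.preimage hc) (fun i => x₀ i) hx₀
  refine funext_set (fun i => Metric.ball (x₀ i) r) (fun i => ?_) fun y hy => ?_
  · rw [Real.ball_eq_Ioo]
    exact Set.Ioo_infinite (by linarith)
  · rw [map_zero]
    exact h (WithLp.toLp 2 y) (hball (by rwa [ball_pi _ hr]))

lemma dense_polyFun_ne_zero {p : MvPolynomial (Fin n) ℝ} (hp : p ≠ 0) :
    Dense {x | polyFun p x ≠ 0} := by
  change Dense {x | polyFun p x = 0}ᶜ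
  rw [← interior_eq_empty_iff_dense_compl]
  by_contra hne
  exact hp (eq_zero_of_polyFun_eq_zero_on_open isOpen_interior
    (Set.nonempty_iff_ne_empty.2 hne) fun x hx =>
      (interior_subset hx : x ∈ {x | polyFun p x = 0}))

lemma polyFun_injective : Function.Injective (polyFun (n := n)) := fun p q h => by
  rw [← sub_eq_zero]
  refine eq_zero_of_polyFun_eq_zero_on_open isOpen_univ ⟨0, trivial⟩ fun x _ => ?_
  have := congrFun h x
  rw [sub_eq_add_neg, polyFun_add, polyFun_neg, this, add_neg_cancel]

/-- The formal Laplacian of a harmonic polynomial vanishes. -/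
lemma sum_pderiv_pderiv_eq_zero {u : MvPolynomial (Fin n) ℝ} (hu : EntireHarmonic (polyFun u)) :
    ∑ i, pderiv i (pderiv i u) = 0 := by
  apply polyFun_injective
  ext x
  have h := hu.laplacian_eq_zero x
  rw [laplacian_eq_sum_fderiv hu.contDiff] at h
  simp only [fderiv_polyFun_single] at h
  simpa [polyFun] using h

lemma MvPolynomial.IsHomogeneous.polyFun_smul {p : MvPolynomial (Fin n) ℝ} {d : ℕ}
    (hp : p.IsHomogeneous d) (t : ℝ) (x : EuclideanSpace ℝ (Fin n)) :
    polyFun p (t • x) = t ^ d * polyFun p x := by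
  simp only [polyFun, eval_eq, Finset.mul_sum]
  refine Finset.sum_congr rfl fun m hm => ?_
  rw [hp.degree_eq_sum_deg_support hm, ← Finset.prod_pow_eq_pow_sum]
  simp only [PiLp.smul_apply, smul_eq_mul, mul_pow, Finset.prod_mul_distrib]
  ring

/-- Rescaling along rays isolates the top-degree form, which lets signs, products and growth bounds
pass from a polynomial to its leading form. -/
lemma tendsto_polyFun_smul_div_pow {p : MvPolynomial (Fin n) ℝ} {d : ℕ} (hd : p.totalDegree ≤ d)
    (x : EuclideanSpace ℝ (Fin n)) :
    Tendsto (fun t : ℝ => polyFun p (t • x) / t ^ d) atTop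
      (𝓝 (polyFun (homogeneousComponent d p) x)) := by
  have hsum : ∑ i ∈ Finset.range (d + 1), homogeneousComponent i p = p := by
    conv_rhs => rw [← sum_homogeneousComponent p]
    refine (Finset.sum_subset (Finset.range_mono (by omega)) fun i _ hi => ?_).symm
    exact homogeneousComponent_eq_zero _ _ (by simpa using hi)
  have hev : ∀ t : ℝ, polyFun p (t • x) =
      ∑ i ∈ Finset.range (d + 1), t ^ i * polyFun (homogeneousComponent i p) x := fun t => by
    conv_lhs => rw [← hsum]
    simp only [← (homogeneousComponent_isHomogeneous _ p).polyFun_smul]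
    simp [polyFun]
  have hlim : Tendsto (fun t : ℝ => ∑ i ∈ Finset.range (d + 1),
      t ^ i / t ^ d * polyFun (homogeneousComponent i p) x) atTop
      (𝓝 (∑ i ∈ Finset.range (d + 1),
        if i = d then polyFun (homogeneousComponent i p) x else 0)) := by
    refine tendsto_finsetSum _ fun i hi => ?_
    split_ifs with h
    · subst h
      refine tendsto_const_nhds.congr' ?_
      filter_upwards [eventually_gt_atTop 0] with t ht
      rw [div_self (pow_pos ht i).ne', one_mul]
    · have hlt : i < d := by have := Finset.mem_range.1 hi; omega
      simpa using (tendsto_pow_div_pow_atTop_zero hlt).mul_const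
        (polyFun (homogeneousComponent i p) x)
  rw [Finset.sum_ite_eq' , if_pos (by simp)] at hlim
  refine hlim.congr fun t => ?_
  rw [hev, Finset.sum_div]
  exact Finset.sum_congr rfl fun i _ => by ring

lemma homogeneousComponent_totalDegree_ne_zero {σ : Type*} {p : MvPolynomial σ ℝ} (hp : p ≠ 0) :
    homogeneousComponent p.totalDegree p ≠ 0 := by
  obtain ⟨m, hm, hmd⟩ := Finset.exists_mem_eq_sup p.support (support_nonempty.2 hp)
    (fun s => s.sum fun _ e => e)
  intro h
  have := congrArg (coeff m) h
  rw [coeff_homogeneousComponent, coeff_zero, if_pos] at this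
  · exact mem_support_iff.1 hm this
  · rw [totalDegree, hmd]; rfl

lemma abs_polyFun_le (p : MvPolynomial (Fin n) ℝ) :
    ∃ A : ℝ, 0 ≤ A ∧ ∃ N : ℕ, ∀ x, |polyFun p x| ≤ A * (1 + ‖x‖) ^ N := by
  induction p using MvPolynomial.induction_on with
  | C a => exact ⟨|a|, abs_nonneg a, 0, fun x => by simp [polyFun]⟩
  | add p q hp hq =>
    obtain ⟨A, hA, N, hN⟩ := hp
    obtain ⟨B, hB, M, hM⟩ := hq
    refine ⟨A + B, by positivity, max N M, fun x => ?_⟩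
    have h1 : 1 ≤ 1 + ‖x‖ := by linarith [norm_nonneg x]
    have := pow_le_pow_right₀ h1 (le_max_left N M)
    have := pow_le_pow_right₀ h1 (le_max_right N M)
    rw [polyFun_add]
    calc _ ≤ |polyFun p x| + |polyFun q x| := abs_add_le _ _
      _ ≤ A * (1 + ‖x‖) ^ N + B * (1 + ‖x‖) ^ M := add_le_add (hN x) (hM x)
      _ ≤ A * (1 + ‖x‖) ^ max N M + B * (1 + ‖x‖) ^ max N M := by gcongr
      _ = _ := by ring
  | mul_X p j hp =>
    obtain ⟨A, hA, N, hN⟩ := hp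
    refine ⟨A, hA, N + 1, fun x => ?_⟩
    rw [polyFun_mul, polyFun_X, abs_mul, pow_succ, ← mul_assoc]
    have : |x j| ≤ ‖x‖ := PiLp.norm_apply_le x j
    gcongr
    · exact hN x
    · linarith

end PolynomialFunctions

/-! ### Gaussian orthogonality of harmonic polynomials -/

section GaussianOrthogonality

variable {n : ℕ}

lemma integrable_pow_mul_exp_neg_half_sq (k : ℕ) :
    Integrable (fun x : ℝ => x ^ k * Real.exp (-(1 / 2) * x ^ 2)) := by
  simpa using integrable_rpow_mul_exp_neg_mul_sq (b := 1 / 2) (by norm_num)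
    (s := k) (by linarith [(Nat.cast_nonneg k : (0 : ℝ) ≤ k)])

/-- The (unnormalised) standard Gaussian density on `ℝⁿ`. -/
noncomputable def gaussianWeight (x : EuclideanSpace ℝ (Fin n)) : ℝ :=
  Real.exp (-(1 / 2) * ‖x‖ ^ 2)

lemma gaussianWeight_pos (x : EuclideanSpace ℝ (Fin n)) : 0 < gaussianWeight x := Real.exp_pos _

lemma hasFDerivAt_gaussianWeight (x : EuclideanSpace ℝ (Fin n)) :
    HasFDerivAt gaussianWeight (-gaussianWeight x • innerSL ℝ x) x := by
  have h := (((hasStrictFDerivAt_norm_sq x).hasFDerivAt).const_mul (-(1 / 2 : ℝ))).exp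
  convert! h using 1
  ext y
  simp [gaussianWeight]

lemma fderiv_gaussianWeight_single (x : EuclideanSpace ℝ (Fin n)) (i : Fin n) :
    fderiv ℝ gaussianWeight x (EuclideanSpace.single i 1) = -(x i * gaussianWeight x) := by
  rw [(hasFDerivAt_gaussianWeight x).fderiv]
  simp [EuclideanSpace.inner_single_right, mul_comm]

lemma continuous_gaussianWeight : Continuous (gaussianWeight (n := n)) := by
  unfold gaussianWeight
  fun_prop

lemma integrable_polyFun_mul_gaussianWeight (p : MvPolynomial (Fin n) ℝ) :
    Integrable (fun x => polyFun p x * gaussianWeight x) := by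
  induction p using MvPolynomial.induction_on' with
  | monomial m a =>
    rw [← (PiLp.volume_preserving_toLp (Fin n)).integrable_comp_emb
      (MeasurableEquiv.toLp 2 (Fin n → ℝ)).measurableEmbedding]
    have h := (Integrable.fintype_prod (μ := fun _ : Fin n => volume)
      fun i => integrable_pow_mul_exp_neg_half_sq (m i)).const_mul a
    refine h.congr (Eventually.of_forall fun x => ?_)
    simp only [Function.comp_apply, polyFun, gaussianWeight, eval_monomial,
      EuclideanSpace.norm_sq_eq, Finset.prod_mul_distrib, Finset.mul_sum, Real.exp_sum]
    rw [Finsupp.prod_fintype _ _ (by simp)]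
    simp [mul_assoc]
  | add p q hp hq =>
    refine (hp.add hq).congr (Eventually.of_forall fun x => ?_)
    simp [polyFun_add, add_mul]

/-- The Gaussian mean of a polynomial. -/
noncomputable def gaussianMean (p : MvPolynomial (Fin n) ℝ) : ℝ :=
  ∫ x, polyFun p x * gaussianWeight x

lemma gaussianMean_add (p q : MvPolynomial (Fin n) ℝ) :
    gaussianMean (p + q) = gaussianMean p + gaussianMean q := by
  rw [gaussianMean, gaussianMean, gaussianMean, ← integral_add
    (integrable_polyFun_mul_gaussianWeight p) (integrable_polyFun_mul_gaussianWeight q)]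
  simp only [polyFun_add, add_mul]

lemma gaussianMean_zero : gaussianMean (0 : MvPolynomial (Fin n) ℝ) = 0 := by
  simp [gaussianMean, polyFun]

lemma gaussianMean_sum {ι : Type*} (s : Finset ι) (p : ι → MvPolynomial (Fin n) ℝ) :
    gaussianMean (∑ i ∈ s, p i) = ∑ i ∈ s, gaussianMean (p i) :=
  map_sum (AddMonoidHom.mk' gaussianMean gaussianMean_add) p s

/-- Gaussian integration by parts. -/
lemma gaussianMean_X_mul (i : Fin n) (p : MvPolynomial (Fin n) ℝ) :
    gaussianMean (X i * p) = gaussianMean (pderiv i p) := by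
  have h := integral_mul_fderiv_eq_neg_fderiv_mul_of_integrable (μ := volume)
    (f := polyFun p) (g := gaussianWeight) (v := EuclideanSpace.single i 1)
    ?_ ?_ (integrable_polyFun_mul_gaussianWeight p)
    (fun x _ => differentiable_polyFun p x)
    (fun x _ => (hasFDerivAt_gaussianWeight x).differentiableAt)
  · simp only [fderiv_polyFun_single, fderiv_gaussianWeight_single] at h
    rw [gaussianMean, gaussianMean, ← neg_inj, ← h, ← integral_neg]
    refine integral_congr_ae (Eventually.of_forall fun x => ?_)
    simp only [polyFun_mul, polyFun_X]
    ring
  · simpa only [fderiv_polyFun_single] using integrable_polyFun_mul_gaussianWeight (pderiv i p)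
  · refine (integrable_polyFun_mul_gaussianWeight (-(X i * p))).congr
      (Eventually.of_forall fun x => ?_)
    simp only [fderiv_gaussianWeight_single, polyFun_neg, polyFun_mul, polyFun_X]
    ring

/-- Homogeneous harmonic polynomials are Gaussian-orthogonal to homogeneous polynomials of
smaller degree. -/
lemma gaussianMean_mul_eq_zero {m : ℕ} : ∀ {k : ℕ} {u g : MvPolynomial (Fin n) ℝ},
    u.IsHomogeneous m → ∑ i, pderiv i (pderiv i u) = 0 → g.IsHomogeneous k → k < m →
    gaussianMean (u * g) = 0 := by
  induction m with
  | zero => intro k u g _ _ _ hk; omega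
  | succ m ih =>
    intro k u g hu hΔ hg hk
    have hu' : (m + 1 : ℝ) * gaussianMean (u * g) = gaussianMean ((m + 1) • u * g) := by
      simp only [gaussianMean, ← integral_const_mul]
      refine integral_congr_ae (Eventually.of_forall fun x => ?_)
      simp [polyFun, mul_assoc]
    -- The partial derivatives commute, so `pderiv i u` is again harmonic, of degree `m`, and the
    -- induction hypothesis applies. The case `k = 0` is separate because the degree `k - 1` of
    -- `pderiv i g` would truncate.
    have hgrad : ∀ i, gaussianMean (pderiv i u * pderiv i g) = 0 := fun i => by
      rcases Nat.eq_zero_or_pos k with rfl | hk0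
      · rw [← totalDegree_zero_iff_isHomogeneous, totalDegree_eq_zero_iff_eq_C] at hg
        rw [hg, pderiv_C, mul_zero, gaussianMean_zero]
      · refine ih (by simpa using hu.pderiv (i := i)) ?_ (hg.pderiv (i := i)) (by omega)
        have hc : ∀ j, pderiv j (pderiv j (pderiv i u)) = pderiv i (pderiv j (pderiv j u)) := by
          intro j
          ext d
          simp only [coeff_pderiv, Finsupp.add_apply]
          rcases eq_or_ne i j with rfl | hij
          · rfl
          · simp only [Finsupp.single_eq_of_ne hij, Finsupp.single_eq_of_ne hij.symm, add_zero]
            rw [show d + Finsupp.single j 1 + Finsupp.single j 1 + Finsupp.single i 1 =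
              d + Finsupp.single i 1 + Finsupp.single j 1 + Finsupp.single j 1 by abel]
            ring
        simp only [hc, ← map_sum, hΔ, map_zero]
    -- Euler's identity rewrites `(m + 1) u` as `∑ Xᵢ ∂ᵢu`. Integrating by parts leaves `Δu · g`,
    -- which is zero, and the gradient terms of `hgrad`.
    have key : gaussianMean ((m + 1) • u * g) = 0 := by
      rw [← hu.sum_X_mul_pderiv, Finset.sum_mul, gaussianMean_sum]
      simp only [mul_assoc, gaussianMean_X_mul, pderiv_mul, gaussianMean_add, hgrad, add_zero]
      rw [← gaussianMean_sum, ← Finset.sum_mul, hΔ, zero_mul, gaussianMean_zero]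
    rw [key] at hu'
    exact (mul_eq_zero.1 hu').resolve_left (by positivity)

lemma eq_zero_of_gaussianMean_eq_zero {p : MvPolynomial (Fin n) ℝ} (hp : ∀ x, 0 ≤ polyFun p x)
    (h : gaussianMean p = 0) : p = 0 := by
  have hae := (integral_eq_zero_iff_of_nonneg
    (fun x => mul_nonneg (hp x) (gaussianWeight_pos x).le)
    (integrable_polyFun_mul_gaussianWeight p)).1 h
  have heq := (Continuous.ae_eq_iff_eq volume
    ((continuous_polyFun p).mul continuous_gaussianWeight) continuous_zero).1 hae
  apply polyFun_injective
  ext x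
  have := congrFun heq x
  simpa [(gaussianWeight_pos x).ne', polyFun] using this

/-- The Laplacian lowers degree by exactly two, so contributions of distinct homogeneous components
cannot cancel. -/
lemma sum_pderiv_pderiv_homogeneousComponent {u : MvPolynomial (Fin n) ℝ}
    (hu : ∑ i, pderiv i (pderiv i u) = 0) (m : ℕ) :
    ∑ i, pderiv i (pderiv i (homogeneousComponent m u)) = 0 := by
  ext d
  have hd := congrArg (coeff d) hu
  simp only [coeff_sum, coeff_pderiv, coeff_homogeneousComponent, map_add,
    Finsupp.degree_single] at hd ⊢
  by_cases h : d.degree + 1 + 1 = m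
  · simpa only [h, if_true] using hd
  · simp [h]

/-- A harmonic polynomial has no nonconstant factor of constant sign. -/
theorem totalDegree_eq_zero_of_nonneg_of_mul_harmonic {g a : MvPolynomial (Fin n) ℝ}
    (hga : g * a ≠ 0) (hΔ : ∑ i, pderiv i (pderiv i (g * a)) = 0) (ha : ∀ x, 0 ≤ polyFun a x) :
    a.totalDegree = 0 := by
  have hg0 : g ≠ 0 := left_ne_zero_of_mul hga
  have ha0 : a ≠ 0 := right_ne_zero_of_mul hga
  set k := g.totalDegree
  set l := a.totalDegree
  by_contra hl
  set gk := homogeneousComponent k g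
  set al := homogeneousComponent l a
  have hdeg : (g * a).totalDegree = k + l := totalDegree_mul_of_isDomain hg0 ha0
  have hlead : homogeneousComponent (k + l) (g * a) = gk * al := by
    apply polyFun_injective
    ext x
    refine tendsto_nhds_unique (tendsto_polyFun_smul_div_pow hdeg.le x) ?_
    rw [polyFun_mul]
    refine ((tendsto_polyFun_smul_div_pow le_rfl x).mul
      (tendsto_polyFun_smul_div_pow le_rfl x)).congr fun t => ?_
    rw [polyFun_mul, pow_add, div_mul_div_comm]
  have hal : ∀ x, 0 ≤ polyFun al x := fun x =>
    ge_of_tendsto (tendsto_polyFun_smul_div_pow le_rfl x) <| by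
      filter_upwards [eventually_ge_atTop 0] with t ht
      exact div_nonneg (ha _) (pow_nonneg ht _)
  -- The orthogonality needs `k < k + l`, which is where `l ≠ 0` enters.
  have hz : gaussianMean (gk * al * gk) = 0 := by
    rw [← hlead]
    exact gaussianMean_mul_eq_zero (homogeneousComponent_isHomogeneous _ _)
      (sum_pderiv_pderiv_homogeneousComponent hΔ _)
      (homogeneousComponent_isHomogeneous k g) (by omega)
  have := eq_zero_of_gaussianMean_eq_zero (fun x => by
    rw [polyFun_mul, polyFun_mul]
    nlinarith [mul_nonneg (hal x) (mul_self_nonneg (polyFun gk x))]) hz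
  exact mul_ne_zero (mul_ne_zero (homogeneousComponent_totalDegree_ne_zero hg0)
    (homogeneousComponent_totalDegree_ne_zero ha0)) (homogeneousComponent_totalDegree_ne_zero hg0)
    this

end GaussianOrthogonality

/-! ### Coprime polynomials with nested zero sets -/

/-- Coprime polynomials over a factorial domain satisfy a Bézout identity with a nonzero
constant. -/
theorem Polynomial.exists_mul_add_mul_eq_C_of_isRelPrime {R : Type*} [CommRing R]
    [IsDomain R] [UniqueFactorizationMonoid R]
    {a b : Polynomial R} (h : IsRelPrime a b) :
    ∃ A B : Polynomial R, ∃ d : R, d ≠ 0 ∧ A * a + B * b = Polynomial.C d := by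
  classical
  obtain ⟨_⟩ : Nonempty (NormalizedGCDMonoid R) := inferInstance
  let K := FractionRing R
  let φ : Polynomial R →+* Polynomial K := Polynomial.mapRingHom (algebraMap R K)
  have hφ : Function.Injective φ := Polynomial.map_injective _ (IsFractionRing.injective R K)
  have hab : φ a ≠ 0 ∨ φ b ≠ 0 := by
    by_contra! hc
    rw [map_eq_zero_iff φ hφ, map_eq_zero_iff φ hφ] at hc
    exact Polynomial.not_isUnit_X (h (hc.1 ▸ dvd_zero (Polynomial.X : Polynomial R))
      (hc.2 ▸ dvd_zero _))
  set D := EuclideanDomain.gcd (φ a) (φ b) with hD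
  have hD0 : D ≠ 0 := fun h0 => by
    rw [EuclideanDomain.gcd_eq_zero_iff] at h0
    tauto
  set N := (IsLocalization.integerNormalization (nonZeroDivisors R) D) with hN
  -- Gauss's lemma: the primitive part of the gcd over the fraction field, denominators cleared,
  -- divides in `R[X]` whatever `D` divides over `K`. Coprimality then makes `D` a unit.
  have hdvd : ∀ q : Polynomial R, D ∣ φ q → N.primPart ∣ q := fun q hq => by
    refine N.isPrimitive_primPart.dvd_of_fraction_map_dvd_fraction_map (K := K) ?_
    obtain ⟨c, hc, hcN⟩ := IsLocalization.integerNormalization_spec (nonZeroDivisors R) D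
    have hc0 : algebraMap R K c ≠ 0 := by
      simpa using nonZeroDivisors.ne_zero hc
    have h1 : N.primPart.map (algebraMap R K) ∣ Polynomial.C (algebraMap R K c) * D := by
      have : Polynomial.C (algebraMap R K c) * D = N.map (algebraMap R K) := by
        rw [hcN]; ext; simp [Algebra.smul_def]
      rw [this]
      exact Polynomial.map_dvd _ N.primPart_dvd
    have hu : IsUnit (Polynomial.C (algebraMap R K c)) := Polynomial.isUnit_C.2 hc0.isUnit
    exact (hu.dvd_mul_left.1 h1).trans hq
  have hDu : IsUnit D := Polynomial.isUnit_or_eq_zero_of_isUnit_integerNormalization_primPart hD0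
    (h (hdvd a (EuclideanDomain.gcd_dvd_left _ _)) (hdvd b (EuclideanDomain.gcd_dvd_right _ _)))
  obtain ⟨E, hE⟩ := hDu.exists_left_inv
  rw [hD, EuclideanDomain.gcd_eq_gcd_ab] at hE
  set α := E * EuclideanDomain.gcdA (φ a) (φ b)
  set β := E * EuclideanDomain.gcdB (φ a) (φ b)
  have hE' : α * φ a + β * φ b = 1 := by linear_combination hE
  have hnorm : ∀ q : Polynomial K, ∃ q' : Polynomial R, ∃ c : R, c ≠ 0 ∧
      φ q' = φ (Polynomial.C c) * q := fun q => by
    obtain ⟨c, hc, hcq⟩ := IsLocalization.integerNormalization_spec (nonZeroDivisors R) q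
    refine ⟨_, c, nonZeroDivisors.ne_zero hc, hcq.trans ?_⟩
    ext
    simp [φ, Algebra.smul_def]
  obtain ⟨A, c, hc, hA⟩ := hnorm α
  obtain ⟨B, c', hc', hB⟩ := hnorm β
  refine ⟨Polynomial.C c' * A, Polynomial.C c * B, c * c', mul_ne_zero hc hc', hφ ?_⟩
  simp only [map_add, map_mul]
  rw [hA, hB]
  linear_combination φ (Polynomial.C c) * φ (Polynomial.C c') * hE'

section CoprimePolynomials

variable {n : ℕ}

/-- Elimination of one variable from two coprime polynomials. -/
lemma exists_elimination (i : Fin n) {a b : MvPolynomial (Fin n) ℝ} (h : IsRelPrime a b) :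
    ∃ A B d : MvPolynomial (Fin n) ℝ, d ≠ 0 ∧ A * a + B * b = d ∧
      ∀ x y : EuclideanSpace ℝ (Fin n), (∀ j, j ≠ i → x j = y j) → polyFun d x = polyFun d y := by
  -- Regard everything as polynomials in `X i` over the ring in the other variables; the Bézout
  -- constant then does not involve `X i`.
  let e : MvPolynomial (Fin n) ℝ ≃ₐ[ℝ] Polynomial (MvPolynomial {j : Fin n // j ≠ i} ℝ) :=
    (renameEquiv ℝ (Equiv.optionSubtypeNe i).symm).trans (optionEquivLeft ℝ {j : Fin n // j ≠ i})
  have hrel : IsRelPrime (e a) (e b) :=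
    IsRelPrime.of_map e.symm (by simpa using h)
  obtain ⟨A, B, d, hd, hAB⟩ := Polynomial.exists_mul_add_mul_eq_C_of_isRelPrime hrel
  have hren : ∀ q, e (rename Subtype.val q) = Polynomial.C q := by
    intro q
    induction q using MvPolynomial.induction_on with
    | C c => simp [e]
    | add p q hp hq => simp only [map_add, hp, hq]
    | mul_X p j hp =>
      rw [map_mul, map_mul, hp, map_mul, rename_X]
      simp [e, j.2]
  refine ⟨e.symm A, e.symm B, rename Subtype.val d, ?_, ?_, fun x y hxy => ?_⟩
  · rwa [Ne, map_eq_zero_iff _ (rename_injective _ Subtype.val_injective)]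
  · apply e.injective
    simp [hren, hAB]
  · simp only [polyFun, eval_rename]
    congr 2
    ext j
    exact hxy j j.2

/-- If `a` and `b` are coprime and `b` vanishes wherever `a` does, then `a` does not change sign. -/
theorem nonneg_of_isRelPrime_of_zeroSet_subset {a b : MvPolynomial (Fin n) ℝ} (ha : a ≠ 0)
    (h : IsRelPrime a b) (hZ : zeroSet (polyFun a) ⊆ zeroSet (polyFun b))
    {x₀ : EuclideanSpace ℝ (Fin n)} (hx₀ : 0 < polyFun a x₀) : ∀ x, 0 ≤ polyFun a x := by
  have hclosed : IsClosed {x | 0 ≤ polyFun a x} :=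
    isClosed_le continuous_const (continuous_polyFun a)
  -- The interior of `{a ≥ 0}` is stable under translation along each axis; being nonempty, it is
  -- then the whole space.
  have htrans : ∀ (i : Fin n) (t : ℝ) (x : EuclideanSpace ℝ (Fin n)),
      x ∈ interior {x | 0 ≤ polyFun a x} →
      x + EuclideanSpace.single i t ∈ interior {x | 0 ≤ polyFun a x} := by
    intro i t x hx
    obtain ⟨A, B, d, hd, hAB, hdi⟩ := exists_elimination i h
    have hgen : ∀ y, polyFun (a * d) y ≠ 0 → 0 ≤ polyFun a y →
        0 ≤ polyFun a (y + EuclideanSpace.single i t) := by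
      intro y hy hy0
      rw [polyFun_mul] at hy
      -- A zero of `a` on this line is also a zero of `b`, hence of `d`; but `d` is constant along
      -- the line and nonzero at `y`.
      have hne : ∀ s : ℝ, polyFun a (y + EuclideanSpace.single i s) ≠ 0 := by
        intro s hs
        have hb : polyFun b (y + EuclideanSpace.single i s) = 0 := hZ hs
        have hds : polyFun d (y + EuclideanSpace.single i s) = 0 := by
          rw [← hAB, polyFun_add, polyFun_mul, polyFun_mul, hs, hb, mul_zero, mul_zero, add_zero]
        refine right_ne_zero_of_mul hy ?_
        rw [← hds]
        exact hdi _ _ fun j hj => by simp [hj]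
      by_contra! hlt
      have hcont : Continuous fun s : ℝ => polyFun a (y + EuclideanSpace.single i s) := by
        exact (continuous_polyFun a).comp
          (continuous_const.add ((PiLp.continuous_toLp 2 _).comp
            (continuous_single (A := fun _ : Fin n => ℝ) i)))
      have h0 : EuclideanSpace.single i (0 : ℝ) = 0 := by ext; simp
      obtain ⟨s, hs⟩ := mem_range_of_exists_le_of_exists_ge hcont (c := 0) ⟨t, hlt.le⟩
        ⟨0, by simpa [h0] using hy0⟩
      exact hne s hs
    have hdense := dense_polyFun_ne_zero (mul_ne_zero ha hd)
    -- `hgen` covers only a dense set of base points. Density within the open interior and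
    -- closedness of `{a ≥ 0}` extend it to the whole translated interior.
    refine mem_interior.2 ⟨(fun y => y - EuclideanSpace.single i t) ⁻¹'
      interior {x | 0 ≤ polyFun a x}, ?_, isOpen_interior.preimage (by fun_prop), by simpa⟩
    intro z hz
    have hcl := hdense.open_subset_closure_inter isOpen_interior hz
    have : z - EuclideanSpace.single i t ∈
        (fun y => y + EuclideanSpace.single i t) ⁻¹' {x | 0 ≤ polyFun a x} := by
      refine closure_minimal ?_ (hclosed.preimage (by fun_prop)) hcl
      exact fun y hy => hgen y hy.2
        (interior_subset hy.1 : y ∈ {x | 0 ≤ polyFun a x})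
    simpa using this
  have hx₀' : x₀ ∈ interior {x | 0 ≤ polyFun a x} :=
    mem_interior.2 ⟨{x | 0 < polyFun a x}, fun x hx => le_of_lt (α := ℝ) hx,
      isOpen_lt continuous_const (continuous_polyFun a), hx₀⟩
  intro x
  have hfin : ∀ s : Finset (Fin n), x₀ + ∑ i ∈ s, EuclideanSpace.single i (x i - x₀ i) ∈
      interior {x | 0 ≤ polyFun a x} := by
    intro s
    induction s using Finset.induction_on with
    | empty => simpa using hx₀'
    | insert i s hi ih =>
      rw [Finset.sum_insert hi, add_comm (EuclideanSpace.single i _), ← add_assoc]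
      exact htrans _ _ _ ih
  have hx : x₀ + ∑ i, EuclideanSpace.single i (x i - x₀ i) = x := by
    ext j
    simp
  have := interior_subset (hfin Finset.univ)
  rwa [hx] at this

/-- A polynomial `v` that is dominated by a harmonic polynomial `u` is divisible by it. -/
theorem dvd_of_abs_le_of_harmonic {u v : MvPolynomial (Fin n) ℝ} (hu0 : u ≠ 0)
    (hu : EntireHarmonic (polyFun u)) {w : EuclideanSpace ℝ (Fin n) → ℝ} (hw : Continuous w)
    (h : ∀ x, |polyFun v x| ≤ w x * |polyFun u x|) : u ∣ v := by
  obtain ⟨a, b, g, hab, hga, hgb⟩ : ∃ a b g, IsRelPrime a b ∧ g * a = u ∧ g * b = v := by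
    obtain ⟨b, a, g, hab, hgb, hga⟩ := UniqueFactorizationMonoid.exists_reduced_factors' v u hu0
    exact ⟨a, b, g, hab.symm, hga, hgb⟩
  have hg0 : g ≠ 0 := by rintro rfl; simp_all
  have ha0 : a ≠ 0 := by rintro rfl; simp_all
  -- Cancel `g` where it is nonzero, then extend by density.
  have hle : ∀ x, |polyFun b x| ≤ w x * |polyFun a x| := by
    have hcl : IsClosed {x | |polyFun b x| ≤ w x * |polyFun a x|} :=
      isClosed_le (continuous_polyFun b).abs (hw.mul (continuous_polyFun a).abs)
    have hsub : {x | polyFun g x ≠ 0} ⊆ {x | |polyFun b x| ≤ w x * |polyFun a x|} := by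
      intro x hx
      have hx' := h x
      rw [← hga, ← hgb, polyFun_mul, polyFun_mul, abs_mul, abs_mul, mul_left_comm] at hx'
      exact le_of_mul_le_mul_left hx' (abs_pos.2 hx)
    intro x
    exact closure_minimal hsub hcl (dense_polyFun_ne_zero hg0 x)
  have hZ : zeroSet (polyFun a) ⊆ zeroSet (polyFun b) := by
    intro x hx
    have := hle x
    rw [show polyFun a x = 0 from hx, abs_zero, mul_zero] at this
    exact abs_eq_zero.1 (le_antisymm this (abs_nonneg _))
  have hΔ := sum_pderiv_pderiv_eq_zero hu
  obtain ⟨x₀, hx₀⟩ : ∃ x, polyFun a x ≠ 0 := (dense_polyFun_ne_zero ha0).nonempty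
  have hdeg : a.totalDegree = 0 := by
    rcases hx₀.lt_or_gt with hlt | hgt
    · have hneg : (-g) * (-a) = u := by rw [neg_mul_neg, hga]
      rw [← totalDegree_neg]
      refine totalDegree_eq_zero_of_nonneg_of_mul_harmonic (g := -g) (hneg ▸ hu0) (hneg ▸ hΔ) ?_
      refine nonneg_of_isRelPrime_of_zeroSet_subset (b := b) (neg_ne_zero.2 ha0) hab.neg_left
        (fun x hx => hZ ?_) (x₀ := x₀) (by rw [polyFun_neg]; linarith)
      have : -polyFun a x = 0 := by rw [← polyFun_neg]; exact hx
      exact neg_eq_zero.1 this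
    · exact totalDegree_eq_zero_of_nonneg_of_mul_harmonic (hga ▸ hu0) (hga ▸ hΔ)
        (nonneg_of_isRelPrime_of_zeroSet_subset ha0 hab hZ hgt)
  rw [totalDegree_eq_zero_iff_eq_C] at hdeg
  have hunit : IsUnit a := by
    rw [hdeg]
    refine (IsUnit.mk0 _ fun h0 => ha0 ?_).map C
    rw [hdeg, h0, C_0]
  rw [← hga, ← hgb]
  exact mul_dvd_mul_left g hunit.dvd

/-- A polynomial bounded by `C (1 + |x|) ^ γ` has degree at most `⌊γ⌋`. -/
theorem totalDegree_le_floor_of_abs_le {p : MvPolynomial (Fin n) ℝ} {γ C : ℝ} (hγ : 0 ≤ γ)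
    (h : ∀ x, |polyFun p x| ≤ C * (1 + ‖x‖) ^ γ) : p.totalDegree ≤ ⌊γ⌋₊ := by
  by_contra! hlt
  have hd : γ < p.totalDegree := (Nat.floor_lt hγ).1 hlt
  have hp0 : p ≠ 0 := by rintro rfl; simp at hlt
  refine homogeneousComponent_totalDegree_ne_zero hp0 (polyFun_injective ?_)
  ext x
  have hC : 0 ≤ C := by
    have := (abs_nonneg _).trans (h 0)
    simpa using this
  have hlim := (tendsto_polyFun_smul_div_pow (p := p) le_rfl x).abs
  have hzero : Tendsto (fun t : ℝ => C * (1 + ‖x‖) ^ γ * t ^ (-(p.totalDegree - γ))) atTop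
      (𝓝 0) := by
    simpa using (tendsto_rpow_neg_atTop (sub_pos.2 hd)).const_mul (C * (1 + ‖x‖) ^ γ)
  have hle : |polyFun (homogeneousComponent p.totalDegree p) x| ≤ 0 := by
    refine le_of_tendsto_of_tendsto hlim hzero ?_
    filter_upwards [eventually_ge_atTop 1] with t ht
    have ht0 : 0 < t := by linarith
    rw [abs_div, abs_of_pos (pow_pos ht0 _), div_le_iff₀ (pow_pos ht0 _)]
    calc |polyFun p (t • x)| ≤ C * (1 + ‖t • x‖) ^ γ := h _
      _ ≤ C * ((1 + ‖x‖) * t) ^ γ := by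
        rw [norm_smul, Real.norm_of_nonneg ht0.le]
        gcongr
        nlinarith [norm_nonneg x]
      _ = C * (1 + ‖x‖) ^ γ * t ^ (-(p.totalDegree - γ)) * t ^ p.totalDegree := by
        rw [Real.mul_rpow (by positivity) ht0.le, ← Real.rpow_natCast t, mul_assoc, mul_assoc,
          ← Real.rpow_add ht0]
        congr 3
        ring_nf
  simpa [polyFun] using abs_eq_zero.1 (le_antisymm hle (abs_nonneg _))

end CoprimePolynomials

/-! ### Entire harmonic functions of polynomial growth -/

section Liouville

variable {n : ℕ}

/-- Exponent at least two makes the truncated power differentiable at the kink, where the slope is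
`max s 0 ^ (k + 1)`. -/
lemma hasDerivAt_max_zero_pow (k : ℕ) (t : ℝ) :
    HasDerivAt (fun s : ℝ => max s 0 ^ (k + 2)) ((k + 2) * max t 0 ^ (k + 1)) t := by
  rcases lt_trichotomy t 0 with ht | rfl | ht
  · have : (fun s : ℝ => max s 0 ^ (k + 2)) =ᶠ[𝓝 t] fun _ => 0 := by
      filter_upwards [Iio_mem_nhds ht] with s hs
      rw [max_eq_right (Set.mem_Iio.1 hs).le, zero_pow (by omega)]
    rw [max_eq_right ht.le, zero_pow (by omega), mul_zero]
    exact (hasDerivAt_const t 0).congr_of_eventuallyEq this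
  · rw [hasDerivAt_iff_tendsto_slope]
    have hc : Continuous fun s : ℝ => max s 0 ^ (k + 1) := by fun_prop
    have h0 := (hc.tendsto 0).mono_left (nhdsWithin_le_nhds (s := {(0 : ℝ)}ᶜ))
    simp only [max_self, ne_eq, Nat.add_eq_zero_iff, one_ne_zero, and_false, not_false_eq_true,
      zero_pow, mul_zero] at h0 ⊢
    refine h0.congr' ?_
    filter_upwards [self_mem_nhdsWithin] with s hs
    have hs0 : s ≠ 0 := hs
    rw [slope_def_field, max_self, zero_pow (by omega), sub_zero, sub_zero, eq_div_iff hs0]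
    rcases le_total s 0 with h | h
    · rw [max_eq_right h, zero_pow (by omega), zero_pow (by omega), zero_mul]
    · rw [max_eq_left h]; ring
  · have : (fun s : ℝ => max s 0 ^ (k + 2)) =ᶠ[𝓝 t] fun s => s ^ (k + 2) := by
      filter_upwards [Ioi_mem_nhds ht] with s hs
      rw [max_eq_left (Set.mem_Ioi.1 hs).le]
    rw [max_eq_left ht.le]
    convert! (hasDerivAt_pow (k + 2) t).congr_of_eventuallyEq this using 1
    push_cast
    rfl

/-- The radial weight `(1 - |y|²)₊ ^ k`, supported in the closed unit ball. -/
noncomputable def ballWeight (k : ℕ) (y : EuclideanSpace ℝ (Fin n)) : ℝ :=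
  max (1 - ‖y‖ ^ 2) 0 ^ k

lemma ballWeight_nonneg (k : ℕ) (y : EuclideanSpace ℝ (Fin n)) : 0 ≤ ballWeight k y :=
  pow_nonneg (le_max_right _ _) k

lemma continuous_ballWeight (k : ℕ) : Continuous (ballWeight (n := n) k) := by
  unfold ballWeight
  fun_prop

lemma ballWeight_eq_zero {k : ℕ} (hk : k ≠ 0) {y : EuclideanSpace ℝ (Fin n)} (hy : 1 ≤ ‖y‖) :
    ballWeight k y = 0 := by
  rw [ballWeight, max_eq_right (by nlinarith), zero_pow hk]

lemma ballWeight_of_norm_le_one (k : ℕ) {y : EuclideanSpace ℝ (Fin n)} (hy : ‖y‖ ≤ 1) :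
    ballWeight k y = (1 - ‖y‖ ^ 2) ^ k := by
  rw [ballWeight, max_eq_left (by nlinarith [norm_nonneg y])]

lemma hasCompactSupport_ballWeight {k : ℕ} (hk : k ≠ 0) :
    HasCompactSupport (ballWeight (n := n) k) :=
  HasCompactSupport.intro (isCompact_closedBall 0 1) fun y hy =>
    ballWeight_eq_zero hk (by simpa using (not_le.1 (mt mem_closedBall_zero_iff.2 hy)).le)

lemma hasFDerivAt_ballWeight (k : ℕ) (y : EuclideanSpace ℝ (Fin n)) :
    HasFDerivAt (ballWeight (k + 2)) ((-(2 * (k + 2)) * ballWeight (k + 1) y) • innerSL ℝ y) y := by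
  have h := (hasDerivAt_max_zero_pow k (1 - ‖y‖ ^ 2)).comp_hasFDerivAt y
    ((hasStrictFDerivAt_norm_sq y).hasFDerivAt.const_sub 1)
  convert! h using 1
  ext z
  simp [ballWeight]
  ring

lemma fderiv_ballWeight_single (k : ℕ) (y : EuclideanSpace ℝ (Fin n)) (i : Fin n) :
    fderiv ℝ (ballWeight (k + 2)) y (EuclideanSpace.single i 1) =
      -(2 * (k + 2)) * (y i * ballWeight (k + 1) y) := by
  rw [(hasFDerivAt_ballWeight k y).fderiv]
  simp [EuclideanSpace.inner_single_right]
  ring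

lemma integrable_mul_ballWeight {k : ℕ} (hk : k ≠ 0) {f : EuclideanSpace ℝ (Fin n) → ℝ}
    (hf : Continuous f) : Integrable (fun y => f y * ballWeight k y) :=
  (hf.mul (continuous_ballWeight k)).integrable_of_hasCompactSupport
    (hasCompactSupport_ballWeight hk).mul_left

lemma integral_ballWeight_pos {k : ℕ} (hk : k ≠ 0) :
    0 < ∫ y : EuclideanSpace ℝ (Fin n), ballWeight k y :=
  (continuous_ballWeight k).integral_pos_of_hasCompactSupport_nonneg_nonzero
    (hasCompactSupport_ballWeight hk) (ballWeight_nonneg k) (x := 0) (by simp [ballWeight])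

/-- The radial derivative of a harmonic function has vanishing weighted mean over balls. -/
lemma integral_fderiv_mul_ballWeight_eq_zero {v : EuclideanSpace ℝ (Fin n) → ℝ}
    (hv : EntireHarmonic v) (k : ℕ) (x : EuclideanSpace ℝ (Fin n)) (r : ℝ) :
    ∫ y, fderiv ℝ v (x + r • y) y * ballWeight (k + 1) y = 0 := by
  have hC := hv.contDiff
  have hC1 : ContDiff ℝ 1 (fderiv ℝ v) := hC.fderiv_right (by norm_num)
  have hline : ContDiff ℝ 1 fun y : EuclideanSpace ℝ (Fin n) => x + r • y := by fun_prop
  let D : Fin n → EuclideanSpace ℝ (Fin n) → ℝ :=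
    fun i z => fderiv ℝ v z (EuclideanSpace.single i 1)
  have hD : ∀ i, ContDiff ℝ 1 (D i) := fun i => hC1.clm_apply contDiff_const
  let DD : Fin n → EuclideanSpace ℝ (Fin n) → ℝ :=
    fun i z => fderiv ℝ (D i) z (EuclideanSpace.single i 1)
  have hDD : ∀ i, Continuous (DD i) := fun i =>
    ((hD i).continuous_fderiv (by norm_num)).clm_apply continuous_const
  have hDr : ∀ i y, fderiv ℝ (fun y => D i (x + r • y)) y (EuclideanSpace.single i 1) =
      r * DD i (x + r • y) := by
    intro i y
    have h1 : HasFDerivAt (fun y : EuclideanSpace ℝ (Fin n) => x + r • y)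
        (r • ContinuousLinearMap.id ℝ _) y := ((hasFDerivAt_id y).const_smul r).const_add x
    have h2 := (((hD i).differentiable (by norm_num)) (x + r • y)).hasFDerivAt.comp y h1
    have h3 : fderiv ℝ (fun y => D i (x + r • y)) y =
      (fderiv ℝ (D i) (x + r • y)).comp (r • ContinuousLinearMap.id ℝ _) := h2.fderiv
    rw [h3]
    simp [DD]
  have hline' : Continuous fun y : EuclideanSpace ℝ (Fin n) => x + r • y := by fun_prop
  -- Up to a constant factor, `yᵢ (1 - |y|²)₊ ^ (k + 1)` is the `i`-th partial derivative of the
  -- next power of the weight. Integrating by parts and summing over `i` produces the Laplacian of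
  -- `v`.
  have hibp : ∀ i, ∫ y, D i (x + r • y) * y i * ballWeight (k + 1) y =
      r / (2 * (k + 2)) * ∫ y, DD i (x + r • y) * ballWeight (k + 2) y := by
    intro i
    have h := integral_mul_fderiv_eq_neg_fderiv_mul_of_integrable (μ := volume)
      (f := fun y => D i (x + r • y)) (g := ballWeight (k + 2)) (v := EuclideanSpace.single i 1)
      ?_ ?_ (integrable_mul_ballWeight (by omega) ((hD i).continuous.comp hline'))
      (fun y _ => (((hD i).comp hline).differentiable (by norm_num)) y)
      (fun y _ => (hasFDerivAt_ballWeight k y).differentiableAt)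
    · simp only [hDr, fderiv_ballWeight_single] at h
      have e1 : ∀ y : EuclideanSpace ℝ (Fin n),
          D i (x + r • y) * (-(2 * (k + 2)) * (y i * ballWeight (k + 1) y)) =
          (-(2 * (k + 2))) * (D i (x + r • y) * y i * ballWeight (k + 1) y) := fun y => by ring
      simp only [e1, mul_assoc r, integral_const_mul] at h
      field_simp
      linarith
    · simp only [hDr]
      exact integrable_mul_ballWeight (by omega) (continuous_const.mul ((hDD i).comp hline'))
    · simp only [fderiv_ballWeight_single]
      have hc : Continuous fun y : EuclideanSpace ℝ (Fin n) =>
          D i (x + r • y) * (-(2 * (k + 2)) * y i) :=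
        ((hD i).continuous.comp hline').mul (by fun_prop)
      refine (integrable_mul_ballWeight (k := k + 1) (by omega) hc).congr
        (Eventually.of_forall fun y => by ring)
  have hsplit : ∀ y : EuclideanSpace ℝ (Fin n), fderiv ℝ v (x + r • y) y * ballWeight (k + 1) y =
      ∑ i, D i (x + r • y) * y i * ballWeight (k + 1) y := by
    intro y
    rw [← Finset.sum_mul]
    congr 1
    have hy : y = ∑ i, y i • EuclideanSpace.single i (1 : ℝ) := by
      ext j
      simp [Pi.single_apply]
    conv_lhs => rw [hy, map_sum]
    refine Finset.sum_congr rfl fun i _ => ?_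
    rw [map_smul, smul_eq_mul, ← hy, mul_comm]
  have hint : ∀ i, Integrable fun y => D i (x + r • y) * y i * ballWeight (k + 1) y := fun i =>
    integrable_mul_ballWeight (by omega) (((hD i).continuous.comp hline').mul (by fun_prop))
  have hint' : ∀ i, Integrable fun y => DD i (x + r • y) * ballWeight (k + 2) y := fun i =>
    integrable_mul_ballWeight (by omega) ((hDD i).comp hline')
  simp only [hsplit]
  rw [integral_finsetSum _ fun i _ => hint i]
  simp only [hibp]
  rw [← Finset.mul_sum, ← integral_finsetSum _ fun i _ => hint' i]
  simp only [← Finset.sum_mul]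
  have hlap : ∀ z, ∑ i, DD i z = 0 := fun z => by
    rw [← hv.laplacian_eq_zero z, laplacian_eq_sum_fderiv hC]
  simp [hlap]

/-- Weighted mean value property of harmonic functions. -/
theorem integral_mul_ballWeight_eq {v : EuclideanSpace ℝ (Fin n) → ℝ} (hv : EntireHarmonic v)
    (k : ℕ) (x : EuclideanSpace ℝ (Fin n)) (r : ℝ) :
    ∫ y, v (x + r • y) * ballWeight (k + 1) y =
      v x * ∫ y : EuclideanSpace ℝ (Fin n), ballWeight (k + 1) y := by
  have hC := hv.contDiff
  have hC1 : Continuous (fderiv ℝ v) := hC.continuous_fderiv (by norm_num)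
  -- The weighted mean is constant in the radius `r`; comparing with `r = 0` gives the claim.
  have hder : ∀ s, HasDerivAt (fun r : ℝ => ∫ y, v (x + r • y) * ballWeight (k + 1) y) 0 s := by
    intro s
    obtain ⟨M, hM⟩ := (isCompact_closedBall x (|s| + 1)).exists_bound_of_continuousOn
      hC1.continuousOn
    have hint : ∀ r : ℝ, Integrable fun y => v (x + r • y) * ballWeight (k + 1) y := fun r =>
      integrable_mul_ballWeight (by omega) (hC.continuous.comp (by fun_prop))
    have hF'c : Continuous fun y => fderiv ℝ v (x + s • y) y * ballWeight (k + 1) y :=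
      ((hC1.comp (by fun_prop)).clm_apply continuous_id).mul (continuous_ballWeight _)
    have h := (hasDerivAt_integral_of_dominated_loc_of_deriv_le (μ := volume)
      (F := fun (r : ℝ) y => v (x + r • y) * ballWeight (k + 1) y)
      (F' := fun (r : ℝ) y => fderiv ℝ v (x + r • y) y * ballWeight (k + 1) y)
      (bound := fun y => M * ballWeight (k + 1) y) (Metric.ball_mem_nhds s one_pos)
      (Eventually.of_forall fun r => (hint r).aestronglyMeasurable) (hint s)
      hF'c.aestronglyMeasurable ?_
      (integrable_mul_ballWeight (by omega) continuous_const) ?_).2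
    · rwa [integral_fderiv_mul_ballWeight_eq_zero hv] at h
    · refine Eventually.of_forall fun y r hr => ?_
      rw [norm_mul, Real.norm_of_nonneg (ballWeight_nonneg _ y)]
      rcases le_total 1 ‖y‖ with hy | hy
      · rw [ballWeight_eq_zero (by omega) hy, mul_zero, mul_zero]
      · refine mul_le_mul_of_nonneg_right ?_ (ballWeight_nonneg _ y)
        have hr' : |r| ≤ |s| + 1 := by
          have h1 : |r - s| < 1 := hr
          have h2 := abs_sub_abs_le_abs_sub r s
          linarith
        have hmem : x + r • y ∈ Metric.closedBall x (|s| + 1) := by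
          rw [mem_closedBall_iff_norm, add_sub_cancel_left, norm_smul, Real.norm_eq_abs]
          nlinarith [abs_nonneg r, norm_nonneg y]
        calc ‖fderiv ℝ v (x + r • y) y‖ ≤ ‖fderiv ℝ v (x + r • y)‖ * ‖y‖ :=
              ContinuousLinearMap.le_opNorm _ _
          _ ≤ ‖fderiv ℝ v (x + r • y)‖ := mul_le_of_le_one_right (norm_nonneg _) hy
          _ ≤ M := hM _ hmem
    · refine Eventually.of_forall fun y r _ => HasDerivAt.mul_const ?_ _
      have h1 : HasDerivAt (fun r : ℝ => x + r • y) y r := by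
        simpa using ((hasDerivAt_id r).smul_const y).const_add x
      exact ((hC.differentiable (by norm_num)) (x + r • y)).hasFDerivAt.comp_hasDerivAt r h1
  have hconst := is_const_of_deriv_eq_zero (fun s => (hder s).differentiableAt)
    (fun s => (hder s).deriv) r 0
  simpa [integral_const_mul] using hconst

/-- Averages of polynomials of bounded degree are polynomials of bounded degree. -/
lemma exists_polyFun_eq_setIntegral {f : EuclideanSpace ℝ (Fin n) → ℝ} (hf : Continuous f) (k : ℕ)
    (ρ : ℝ) : ∃ q : MvPolynomial (Fin n) ℝ, q.totalDegree ≤ 2 * k ∧ ∀ x, polyFun q x =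
      ∫ w in Metric.closedBall (0 : EuclideanSpace ℝ (Fin n)) 1,
        f w * (1 - ‖w - ρ • x‖ ^ 2) ^ k := by
  let A := ContinuousMap (EuclideanSpace ℝ (Fin n)) ℝ
  let coord : Fin n → A := fun i => ⟨fun w => w i, by fun_prop⟩
  -- The kernel is a polynomial in `x` with coefficients continuous in `w`; integrating these
  -- coefficients against `f` gives `q`.
  let p : MvPolynomial (Fin n) A :=
    (1 - ∑ i, (C (coord i) - C (ContinuousMap.const _ ρ) * X i) ^ 2) ^ k
  have hp : p.totalDegree ≤ 2 * k := by
    have h1 : ∀ i, (C (coord i) - C (ContinuousMap.const _ ρ) * X i :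
        MvPolynomial (Fin n) A).totalDegree ≤ 1 := by
      intro i
      refine (totalDegree_sub _ _).trans (max_le (by simp) ?_)
      exact (totalDegree_mul _ _).trans (by simp [totalDegree_X])
    have h2 : (1 - ∑ i, (C (coord i) - C (ContinuousMap.const _ ρ) * X i) ^ 2 :
        MvPolynomial (Fin n) A).totalDegree ≤ 2 := by
      refine (totalDegree_sub _ _).trans (max_le (by simp) ?_)
      refine totalDegree_finsetSum_le fun i _ => (totalDegree_pow _ _).trans ?_
      have := h1 i
      omega
    refine (totalDegree_pow _ _).trans ?_
    rw [mul_comm]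
    exact Nat.mul_le_mul_right k h2
  have hev : ∀ w x : EuclideanSpace ℝ (Fin n), (1 - ‖w - ρ • x‖ ^ 2) ^ k =
      ∑ m ∈ p.support, (coeff m p) w * ∏ i, x i ^ m i := by
    intro w x
    let ev : A →+* ℝ := (Pi.evalRingHom (fun _ => ℝ) w).comp ContinuousMap.coeFnRingHom
    have h := eval₂_eq' ev (fun i => x i) p
    have hc : ∀ m, ev (coeff m p) = (coeff m p) w := fun m => rfl
    simp only [hc] at h
    rw [← h]
    simp only [p, eval₂_pow, eval₂_sub, eval₂_one, eval₂_sum, eval₂_mul, eval₂_C, eval₂_X,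
      EuclideanSpace.norm_sq_eq]
    simp only [PiLp.sub_apply, PiLp.smul_apply, smul_eq_mul, Real.norm_eq_abs, sq_abs]
    rfl
  refine ⟨∑ m ∈ p.support, monomial m
    (∫ w in Metric.closedBall (0 : EuclideanSpace ℝ (Fin n)) 1, f w * (coeff m p) w), ?_, ?_⟩
  · refine totalDegree_finsetSum_le fun m hm => (totalDegree_monomial_le _ _).trans ?_
    exact (le_totalDegree hm).trans hp
  · intro x
    have hint : ∀ m : Fin n →₀ ℕ, IntegrableOn (fun w => f w * (coeff m p) w * ∏ i, x i ^ m i)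
        (Metric.closedBall (0 : EuclideanSpace ℝ (Fin n)) 1) := fun m =>
      ((hf.mul (coeff m p).continuous).mul continuous_const).continuousOn.integrableOn_compact
        (isCompact_closedBall _ _)
    simp only [hev, Finset.mul_sum, ← mul_assoc]
    rw [integral_finsetSum _ fun m _ => hint m]
    simp only [integral_mul_const, polyFun, map_sum, eval_monomial]
    refine Finset.sum_congr rfl fun m _ => ?_
    rw [Finsupp.prod_fintype _ _ (by simp)]

/-- Near the unit sphere, the truncated weight differs little from the polynomial weight. -/
lemma abs_ballWeight_sub_indicator_le {k : ℕ} (hk : k ≠ 0) {w a : EuclideanSpace ℝ (Fin n)}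
    (ha : ‖a‖ ≤ 1) :
    |ballWeight k (w - a) - (Metric.closedBall (0 : EuclideanSpace ℝ (Fin n)) 1).indicator
      (fun w => (1 - ‖w - a‖ ^ 2) ^ k) w| ≤ (3 * ‖a‖) ^ k := by
  have h1 := norm_sub_le w a
  have h2 := norm_sub_norm_le w a
  have h0 := norm_nonneg (w - a)
  have ha0 := norm_nonneg a
  -- The two weights differ only when `w` lies in exactly one of the two unit balls; there `‖w - a‖`
  -- is within `‖a‖` of `1`, so `|1 - ‖w - a‖²| ≤ 2‖a‖ + ‖a‖² ≤ 3‖a‖`.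
  by_cases hw : ‖w‖ ≤ 1
  · rw [Set.indicator_of_mem (by simpa using hw)]
    rcases le_total ‖w - a‖ 1 with h | h
    · rw [ballWeight_of_norm_le_one k h, sub_self, abs_zero]
      positivity
    · rw [ballWeight_eq_zero hk h, zero_sub, abs_neg, abs_pow]
      refine pow_le_pow_left₀ (abs_nonneg _) ?_ k
      rw [abs_le]
      constructor <;> nlinarith
  · rw [Set.indicator_of_notMem (by simpa using hw), sub_zero]
    rcases le_total ‖w - a‖ 1 with h | h
    · rw [ballWeight_of_norm_le_one k h, abs_pow]
      refine pow_le_pow_left₀ (abs_nonneg _) ?_ k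
      rw [abs_le]
      constructor <;> nlinarith
    · rw [ballWeight_eq_zero hk h, abs_zero]
      positivity

/-- Liouville's theorem: entire harmonic functions of polynomial growth are polynomials. -/
theorem exists_polyFun_eq_of_harmonic_of_growth {v : EuclideanSpace ℝ (Fin n) → ℝ}
    (hv : EntireHarmonic v) {A : ℝ} {N : ℕ} (hA : 0 ≤ A)
    (hgrowth : ∀ x, |v x| ≤ A * (1 + ‖x‖) ^ N) : ∃ V : MvPolynomial (Fin n) ℝ, polyFun V = v := by
  have hvc : Continuous v := hv.contDiff.continuous
  set c := ∫ y : EuclideanSpace ℝ (Fin n), ballWeight (N + 1) y with hc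
  have hc0 : 0 < c := integral_ballWeight_pos (by omega)
  -- Integrating over a ball independent of `x` makes the average polynomial in `x`. The exponent `N
  -- + 1` makes the error `O(R ^ N · R ^ (-(N + 1)))`, which tends to zero.
  choose q hqdeg hq using fun R : ℝ =>
    exists_polyFun_eq_setIntegral (f := fun w => v (R • w)) (hvc.comp (by fun_prop)) (N + 1) R⁻¹
  have hlim : ∀ x, Tendsto (fun R => polyFun (q R) x) atTop (𝓝 (v x * c)) := by
    intro x
    set B := volume.real (Metric.closedBall (0 : EuclideanSpace ℝ (Fin n)) 2)
    have hbound : ∀ᶠ R : ℝ in atTop, ‖polyFun (q R) x - v x * c‖ ≤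
        A * 3 ^ N * (3 * ‖x‖) ^ (N + 1) * B * R⁻¹ := by
      filter_upwards [eventually_ge_atTop 1, eventually_ge_atTop ‖x‖] with R hR1 hRx
      have hR0 : 0 < R := by linarith
      set a := R⁻¹ • x with ha
      have hna : ‖a‖ = ‖x‖ / R := by
        rw [ha, norm_smul, norm_inv, Real.norm_of_nonneg hR0.le, inv_mul_eq_div]
      have ha1 : ‖a‖ ≤ 1 := by rw [hna]; exact (div_le_one hR0).2 hRx
      let I := (Metric.closedBall (0 : EuclideanSpace ℝ (Fin n)) 1).indicator
        fun w => (1 - ‖w - a‖ ^ 2) ^ (N + 1)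
      -- Mean value property on radius `R`, with the substitution `w = y + x / R`.
      have hmean : v x * c = ∫ w, v (R • w) * ballWeight (N + 1) (w - a) := by
        rw [← integral_mul_ballWeight_eq hv N x R, ← integral_sub_right_eq_self _ a]
        refine integral_congr_ae (Eventually.of_forall fun w => ?_)
        simp only [ha, smul_sub, smul_smul, mul_inv_cancel₀ hR0.ne', one_smul, add_sub_cancel]
      have hpoly : polyFun (q R) x = ∫ w, v (R • w) * I w := by
        rw [hq, ← integral_indicator measurableSet_closedBall]
        refine integral_congr_ae (Eventually.of_forall fun w => ?_)
        exact Set.indicator_mul_right _ _ _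
      have hint1 : Integrable fun w => v (R • w) * ballWeight (N + 1) (w - a) := by
        have := (integrable_mul_ballWeight (k := N + 1) (by omega)
          (hvc.comp (by fun_prop : Continuous fun w => x + R • w))).comp_sub_right a
        refine this.congr (Eventually.of_forall fun w => ?_)
        simp only [Function.comp_apply, ha, smul_sub, smul_smul, mul_inv_cancel₀ hR0.ne',
          one_smul, add_sub_cancel]
      have hint2 : Integrable fun w => v (R • w) * I w := by
        have hcont : Continuous fun w : EuclideanSpace ℝ (Fin n) =>
            v (R • w) * (1 - ‖w - a‖ ^ 2) ^ (N + 1) :=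
          (hvc.comp (by fun_prop)).mul (by fun_prop)
        have := (integrable_indicator_iff measurableSet_closedBall).2
          (hcont.continuousOn.integrableOn_compact (μ := volume)
            (isCompact_closedBall (0 : EuclideanSpace ℝ (Fin n)) 1))
        refine this.congr (Eventually.of_forall fun w => ?_)
        exact Set.indicator_mul_right _ _ _
      rw [norm_sub_rev, hmean, hpoly, ← integral_sub hint1 hint2]
      have hsupp : ∀ w, w ∉ Metric.closedBall (0 : EuclideanSpace ℝ (Fin n)) 2 →
          v (R • w) * ballWeight (N + 1) (w - a) - v (R • w) * I w = 0 := by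
        intro w hw
        have hw' : 2 < ‖w‖ := by simpa using hw
        have h1 : 1 ≤ ‖w - a‖ := by linarith [norm_sub_norm_le w a]
        rw [ballWeight_eq_zero (by omega) h1]
        simp only [I]
        rw [Set.indicator_of_notMem (by simp; linarith)]
        simp
      rw [← setIntegral_eq_integral_of_forall_compl_eq_zero hsupp]
      have hle : ∀ w ∈ Metric.closedBall (0 : EuclideanSpace ℝ (Fin n)) 2,
          ‖v (R • w) * ballWeight (N + 1) (w - a) - v (R • w) * I w‖ ≤
            A * 3 ^ N * (3 * ‖x‖) ^ (N + 1) * R⁻¹ := by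
        intro w hw
        have hw' : ‖w‖ ≤ 2 := by simpa using hw
        rw [← mul_sub, norm_mul, Real.norm_eq_abs, Real.norm_eq_abs]
        have hvle : |v (R • w)| ≤ A * (3 * R) ^ N := by
          refine (hgrowth _).trans ?_
          gcongr
          rw [norm_smul, Real.norm_of_nonneg hR0.le]
          nlinarith
        calc _ ≤ A * (3 * R) ^ N * (3 * ‖a‖) ^ (N + 1) :=
              mul_le_mul hvle (abs_ballWeight_sub_indicator_le (by omega) ha1) (abs_nonneg _)
                (by positivity)
          _ = A * 3 ^ N * (3 * ‖x‖) ^ (N + 1) * R⁻¹ := by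
            rw [hna, ← mul_div_assoc, div_pow, mul_pow 3 R]
            field_simp
            ring
      refine (norm_setIntegral_le_of_norm_le_const measure_closedBall_lt_top hle).trans_eq ?_
      simp only [B]
      ring
    rw [tendsto_iff_norm_sub_tendsto_zero]
    refine squeeze_zero' (Eventually.of_forall fun R => norm_nonneg _) hbound ?_
    simpa using tendsto_inv_atTop_zero.const_mul (A * 3 ^ N * (3 * ‖x‖) ^ (N + 1) * B)
  let Φ : MvPolynomial (Fin n) ℝ →ₗ[ℝ] (EuclideanSpace ℝ (Fin n) → ℝ) :=
    { toFun := polyFun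
      map_add' := fun p q => funext (polyFun_add p q)
      map_smul' := fun r p => funext fun x => by simp [polyFun] }
  let W := (restrictTotalDegree (Fin n) ℝ (2 * (N + 1))).map Φ
  -- The degree bound `2 (N + 1)` does not depend on `R`, so the approximants lie in one
  -- finite-dimensional space, closed under pointwise limits.
  have hW : IsClosed (W : Set (EuclideanSpace ℝ (Fin n) → ℝ)) := W.closed_of_finiteDimensional
  have hmem : (fun x => v x * c) ∈ W := by
    refine hW.mem_of_tendsto (tendsto_pi_nhds.2 hlim) (Eventually.of_forall fun R => ?_)
    exact Submodule.mem_map_of_mem ((mem_restrictTotalDegree _ _ _).2 (hqdeg R))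
  obtain ⟨V, -, hV⟩ := hmem
  refine ⟨c⁻¹ • V, ?_⟩
  have : Φ (c⁻¹ • V) = v := by
    rw [map_smul, hV]
    ext x
    simp only [Pi.smul_apply, smul_eq_mul]
    field_simp
  exact this

end Liouville

theorem mainTheorem2 (n : ℕ) (hn : 2 ≤ n)
    (u : MvPolynomial (Fin n) ℝ) (hu0 : u ≠ 0) (hu : EntireHarmonic (polyFun u))
    (v : EuclideanSpace ℝ (Fin n) → ℝ) (hv : EntireHarmonic v)
    (hZ : zeroSet (polyFun u) ⊆ zeroSet v)
    (γ C : ℝ) (hγ : 0 ≤ γ) (hC : 0 < C)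
    (hgrowth : ∀ x, x ∉ zeroSet (polyFun u) → |v x / polyFun u x| ≤ C * (1 + ‖x‖) ^ γ) :
    ∃ R : MvPolynomial (Fin n) ℝ, R.totalDegree ≤ ⌊γ⌋₊ ∧
      ∀ x, x ∉ zeroSet (polyFun u) → v x / polyFun u x = polyFun R x := by
  have hle : ∀ x, |v x| ≤ C * (1 + ‖x‖) ^ γ * |polyFun u x| := by
    intro x
    by_cases hx : polyFun u x = 0
    · rw [show v x = 0 from hZ hx, hx, abs_zero, mul_zero]
    · rw [← div_le_iff₀ (abs_pos.2 hx), ← abs_div]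
      exact hgrowth x hx
  have hpos : ∀ x : EuclideanSpace ℝ (Fin n), 1 ≤ 1 + ‖x‖ := fun x => by
    linarith [norm_nonneg x]
  obtain ⟨A, hA, N, hN⟩ := abs_polyFun_le u
  -- Liouville needs a natural exponent: round `γ` up and add the growth exponent of `u`.
  obtain ⟨V, rfl⟩ := exists_polyFun_eq_of_harmonic_of_growth hv (A := C * A) (N := ⌈γ⌉₊ + N)
    (by positivity) fun x => by
      have h1 : (1 + ‖x‖) ^ γ ≤ (1 + ‖x‖) ^ ⌈γ⌉₊ := by
        rw [← Real.rpow_natCast]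
        exact Real.rpow_le_rpow_of_exponent_le (hpos x) (Nat.le_ceil γ)
      calc |v x| ≤ C * (1 + ‖x‖) ^ γ * |polyFun u x| := hle x
        _ ≤ C * (1 + ‖x‖) ^ ⌈γ⌉₊ * (A * (1 + ‖x‖) ^ N) := by
          gcongr
          exact hN x
        _ = C * A * (1 + ‖x‖) ^ (⌈γ⌉₊ + N) := by ring
  have hw : Continuous fun x : EuclideanSpace ℝ (Fin n) => C * (1 + ‖x‖) ^ γ :=
    continuous_const.mul ((continuous_const.add continuous_norm).rpow_const fun x =>
      Or.inr hγ)
  obtain ⟨R, rfl⟩ := dvd_of_abs_le_of_harmonic hu0 hu hw hle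
  have hquot : ∀ x, x ∉ zeroSet (polyFun u) →
      polyFun (u * R) x / polyFun u x = polyFun R x := fun x hx => by
    rw [polyFun_mul, mul_div_cancel_left₀ _ hx]
  refine ⟨R, totalDegree_le_floor_of_abs_le (C := C) hγ fun x => ?_, hquot⟩
  -- The growth bound is known only off `Z(u)`; that set is dense, so continuity extends it to all
  -- points.
  have hcl : IsClosed {x | |polyFun R x| ≤ C * (1 + ‖x‖) ^ γ} :=
    isClosed_le (continuous_polyFun R).abs hw
  refine closure_minimal (fun y hy => ?_) hcl (dense_polyFun_ne_zero hu0 x)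
  have := hgrowth y hy
  rwa [hquot y hy] at this
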